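/- **Setting.** Let $[n]=\{1,\dots,n\}$, order $\mathbb{R}^n$ coordinatewise, and for every $i\in[n]$ let $A_i$ be a finite nonempty set. For $i\in[n]$ and $a\in A_i$ let $f_i^a:\mathbb{R}^n\to\mathbb{R}$ be order-preserving, convex, additively homogeneous ($f_i^a(\lambda+x)=\lambda+f_i^a(x)$ for $\lambda\in\mathbb{R}$, where $\lambda + x=(\lambda+x_j)_j$) and polyhedral ($\mathbb{R}^n$ is covered by finitely many polyhedra on each of which $f_i^a$ is affine). Let $f:\mathbb{R}^n\to\mathbb{R}^n$ be given by $f_i(x)=\min_{a\in A_i}f_i^a(x)$, and, for a strategy $\sigma\in\prod_i A_i$, let $f^{(\sigma)}$ be the map with coordinates $f^{(\sigma)}_i=f_i^{\sigma(i)}$. A *half-line* is a map $w:t\mapsto t\eta+v$ with $\eta,v\in\mathbb{R}^n$ ($\eta$ is its slope), identified with the couple $(\eta,v)$; it is *invariant* by a self-map $g$ of $\mathbb{R}^n$ if $g(w(t))=w(t+1)$ for $t$ large enough. The *cycle time* of $g$ is $\chi(g)=\lim_{m\to\infty}g^m(y)/m$, with $y\in\mathbb{R}^n$ arbitrary. Let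 $\hat g(\eta)=\lim_{t\to\infty}g(t\eta)/t$ and $g_\eta(v)=\lim_{t\to\infty}\bigl(g(t\eta+v)-t\hat g(\eta)\bigr)$, and, for a given slope $\eta$, let $\bar g(y)=g_\eta(y)-\eta$. The *subdifferential* of a self-map $h$ of $\mathbb{R}^n$ at $u$ is the set $\partial h(u)$ of the matrices $M\in\mathbb{R}^{n\times n}$ such that $h(x)-h(u)\ge M(x-u)$ for all $x\in\mathbb{R}^n$. A *recurrence class* of $M$ is a final communication class $F$ of the graph of $M$ such that the $F\times F$ submatrix of $M$ is stochastic. If $h$ is convex, order-preserving and additively homogeneous and has a fixed point $u$, its *critical nodes* are the elements of the recurrence classes of the matrices $M\in\partial h(u)$; they do not depend on the choice of the fixed point $u$. If $g$ has an invariant half-line $(\eta,v)$, the critical nodes of $g$ are, by definition, those of $\bar g:y\mapsto g_\eta(y)-\eta$. The *spectral projection* of a half-line $w:t\mapsto t\eta+v$ by $g$ is the half-line $g^\omega(w):t\mapsto t\eta+\lim_{m\to\infty}\bar g^{\,m}(v)$. **Policy iteration algorithm.** Start with an arbitrary strategy $\sigma_0$ and an arbitrary invariant half-line $w^{(0)}$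 of $f^{(\sigma_0)}$. At iteration $k$, stop if $f(w^{(k)}(t))=w^{(k)}(t+1)$ for $t$ large enough. Otherwise: * choose a strategy $\sigma_{k+1}$ such that $f(w^{(k)}(t))=f^{(\sigma_{k+1})}(w^{(k)}(t))$ for $t$ large enough, in a conservative way: $\sigma_{k+1}(i)=\sigma_k(i)$ for every $i$ such that $f_i(w^{(k)}(t))=f^{(\sigma_k)}_i(w^{(k)}(t))$ for $t$ large enough; * take an arbitrary invariant half-line $w'$ of $f^{(\sigma_{k+1})}$. If its slope differs from that of $w^{(k)}$, set $w^{(k+1)}=w'$; otherwise set $w^{(k+1)}=(f^{(\sigma_{k+1})})^\omega(w^{(k)})$. **Lemma.** Let $(\sigma_k)$ and $(w^{(k)})$ be the strategies and half-lines produced by a run of this algorithm, and let $k$ be an iteration, at which the algorithm does not stop, such that $\chi(f^{(\sigma_{k+1})})=\chi(f^{(\sigma_k)})$ (a degenerate iteration). Then: 1. the half-line $w^{(k+1)}$ agrees with $w^{(k)}$ on the set of critical nodes of $f^{(\sigma_{k+1})}$, that is, $w^{(k+1)}_i(t)=w^{(k)}_i(t)$ for all $t\in\mathbb{R}$ and every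 such node $i$; 2. every critical node of $f^{(\sigma_{k+1})}$ is a critical node of $f^{(\sigma_k)}$; 3. $w^{(k+1)}\le w^{(k)}$, that is, $w^{(k+1)}(t)\le w^{(k)}(t)$ for all $t\in\mathbb{R}$. -/

import Mathlib

open Filter Topology

namespace MeanPayoff

/-- A polyhedron of `ℝⁿ`: the intersection of finitely many closed half-spaces. -/
def IsPolyhedron {n : ℕ} (S : Set (Fin n → ℝ)) : Prop :=
  ∃ (m : ℕ) (a : Fin m → Fin n → ℝ) (b : Fin m → ℝ), S = {x | ∀ j, a j ⬝ᵥ x ≤ b j}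

/-- A map `ℝⁿ → ℝ` is polyhedral if `ℝⁿ` is covered by finitely many polyhedra, on each of which
the map is affine. -/
def IsPolyhedralMap {n : ℕ} (φ : (Fin n → ℝ) → ℝ) : Prop :=
  ∃ (N : ℕ) (S : Fin N → Set (Fin n → ℝ)),
    (∀ j, IsPolyhedron (S j)) ∧ (⋃ j, S j) = Set.univ ∧
    ∀ j, ∃ (p : Fin n → ℝ) (c : ℝ), ∀ x ∈ S j, φ x = p ⬝ᵥ x + c

/-- Additive homogeneity: the map commutes with the addition of a constant vector. -/
def AddHomogeneous {n : ℕ} (φ : (Fin n → ℝ) → ℝ) : Prop :=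
  ∀ (c : ℝ) (x : Fin n → ℝ), φ (fun j => c + x j) = c + φ x

/-- A half-line `t ↦ t η + v`, identified with (the germ at infinity given by) the couple
`(η, v)`. -/
structure HalfLine (n : ℕ) where
  /-- the slope `η` -/
  slope : Fin n → ℝ
  /-- the vector `v` -/
  base : Fin n → ℝ

/-- The value `t η + v` of a half-line at time `t`. -/
def HalfLine.eval {n : ℕ} (w : HalfLine n) (t : ℝ) : Fin n → ℝ :=
  t • w.slope + w.base

/-- `w` is an invariant half-line of `g`: `g (w t) = w (t + 1)` for `t` large enough. -/
def IsInvariant {n : ℕ} (g : (Fin n → ℝ) → (Fin n → ℝ)) (w : HalfLine n) : Prop :=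
  ∀ᶠ t : ℝ in atTop, g (w.eval t) = w.eval (t + 1)

/-- The cycle time `χ(g) = lim gᵏ(y) / k`, computed from the orbit of `y = 0` (for maps that are
nonexpansive in the sup-norm the limit does not depend on `y`). -/
noncomputable def cycleTime {n : ℕ} (g : (Fin n → ℝ) → (Fin n → ℝ)) : Fin n → ℝ :=
  limUnder atTop (fun k : ℕ => (k : ℝ)⁻¹ • g^[k] 0)

/-- The recession function `ĝ(η) = lim g(t η) / t`, as `t → ∞`. -/
noncomputable def recession {n : ℕ} (g : (Fin n → ℝ) → (Fin n → ℝ)) (η : Fin n → ℝ) : Fin n → ℝ :=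
  fun i => limUnder atTop (fun t : ℝ => g (t • η) i / t)

/-- The tangent of `g` at infinity around the slope `η`:
`g_η(v) = lim (g(t η + v) - t ĝ(η))`, as `t → ∞`. -/
noncomputable def tangent {n : ℕ} (g : (Fin n → ℝ) → (Fin n → ℝ)) (η v : Fin n → ℝ) : Fin n → ℝ :=
  fun i => limUnder atTop (fun t : ℝ => g (t • η + v) i - t * recession g η i)

/-- The map `ḡ : y ↦ g_η(y) - η`. -/
noncomputable def reducedMap {n : ℕ} (g : (Fin n → ℝ) → (Fin n → ℝ)) (η : Fin n → ℝ) :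
    (Fin n → ℝ) → (Fin n → ℝ) :=
  fun y => tangent g η y - η

/-- The subdifferential of a self-map `g` of `ℝⁿ` at `u`: the matrices `M` such that
`g(x) - g(u) ≥ M (x - u)` for all `x`. -/
def subdifferential {n : ℕ} (g : (Fin n → ℝ) → (Fin n → ℝ)) (u : Fin n → ℝ) :
    Set (Matrix (Fin n) (Fin n) ℝ) :=
  {M | ∀ x, M.mulVec (x - u) ≤ g x - g u}

/-- `j` is accessible from `i` in the graph of the matrix `M`. -/
def Accessible {n : ℕ} (M : Matrix (Fin n) (Fin n) ℝ) : Fin n → Fin n → Prop :=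
  Relation.ReflTransGen (fun i j => M i j ≠ 0)

/-- `F` is a recurrence class of `M`: a final communication class of the graph of `M` such that
the `F × F` submatrix of `M` is stochastic. -/
structure IsRecurrenceClass {n : ℕ} (M : Matrix (Fin n) (Fin n) ℝ) (F : Finset (Fin n)) :
    Prop where
  nonempty : F.Nonempty
  communication : ∀ i ∈ F, ∀ j, j ∈ F ↔ Accessible M i j ∧ Accessible M j i
  final : ∀ i ∈ F, ∀ j, j ∉ F → M i j = 0
  stochastic : M.submatrix (fun i : F => (i : Fin n)) (fun j : F => (j : Fin n)) ∈
    Matrix.rowStochastic ℝ F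

/-- The critical nodes of a self-map `g` of `ℝⁿ` having a harmonic vector (a fixed point): the
nodes which belong to a recurrence class of some matrix in the subdifferential of `g` at a
harmonic vector `u`. For convex, order preserving and additively homogeneous maps, this does not
depend on the choice of `u`. -/
def harmonicCriticalNodes {n : ℕ} (g : (Fin n → ℝ) → (Fin n → ℝ)) : Set (Fin n) :=
  {i | ∃ u, g u = u ∧ ∃ M ∈ subdifferential g u, ∃ F, IsRecurrenceClass M F ∧ i ∈ F}

/-- The critical nodes of a self-map `g` of `ℝⁿ` having an invariant half-line `(η, v)`: those of
the map `ḡ : y ↦ g_η(y) - η`. The slope `η` is the same for all the invariant half-lines of a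
map that is nonexpansive in the sup-norm. -/
def criticalNodes {n : ℕ} (g : (Fin n → ℝ) → (Fin n → ℝ)) : Set (Fin n) :=
  {i | ∃ w : HalfLine n, IsInvariant g w ∧ i ∈ harmonicCriticalNodes (reducedMap g w.slope)}

/-- The spectral projector `g^ω(u) = lim gᵏ(u)`. -/
noncomputable def spectralProjector {n : ℕ} (g : (Fin n → ℝ) → (Fin n → ℝ)) (u : Fin n → ℝ) :
    Fin n → ℝ :=
  limUnder atTop (fun k : ℕ => g^[k] u)

/-- The spectral projector acting on half-lines: `g^ω(w) : t ↦ t η + ḡ^ω(v)` for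
`w : t ↦ t η + v`. -/
noncomputable def spectralProjectorHalfLine {n : ℕ} (g : (Fin n → ℝ) → (Fin n → ℝ))
    (w : HalfLine n) : HalfLine n where
  slope := w.slope
  base := spectralProjector (reducedMap g w.slope) w.base

/-- The self-map `f` of `ℝⁿ` with coordinates `f_i = min_{a ∈ A_i} f_i^a`. -/
noncomputable def minMap {n : ℕ} {A : Fin n → Type*} [∀ i, Fintype (A i)] [∀ i, Nonempty (A i)]
    (fa : (i : Fin n) → A i → (Fin n → ℝ) → ℝ) : (Fin n → ℝ) → (Fin n → ℝ) :=
  fun x i => Finset.univ.inf' Finset.univ_nonempty (fun a => fa i a x)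

/-- The self-map `f^(σ)` of `ℝⁿ` with coordinates `f_i^{σ(i)}`. -/
def strategyMap {n : ℕ} {A : Fin n → Type*} (fa : (i : Fin n) → A i → (Fin n → ℝ) → ℝ)
    (σ : (i : Fin n) → A i) : (Fin n → ℝ) → (Fin n → ℝ) :=
  fun x i => fa i (σ i) x

/-- One (complete) iteration of the policy iteration algorithm, from the strategy `σ` and the
half-line `w` to the strategy `σ'` and the half-line `w₁`. -/
structure IsIteration {n : ℕ} {A : Fin n → Type*} [∀ i, Fintype (A i)] [∀ i, Nonempty (A i)]
    (fa : (i : Fin n) → A i → (Fin n → ℝ) → ℝ)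
    (σ : (i : Fin n) → A i) (w : HalfLine n) (σ' : (i : Fin n) → A i) (w₁ : HalfLine n) :
    Prop where
  /-- the stopping test has failed -/
  not_stop : ¬ IsInvariant (minMap fa) w
  /-- the strategy is improved -/
  improve : ∀ᶠ t : ℝ in atTop, minMap fa (w.eval t) = strategyMap fa σ' (w.eval t)
  /-- the improvement is conservative -/
  conservative : ∀ i, (∀ᶠ t : ℝ in atTop, minMap fa (w.eval t) i = strategyMap fa σ (w.eval t) i) →
    σ' i = σ i
  /-- an arbitrary invariant half-line `w'` of the map of the new strategy is computed; it is the
  new half-line if its slope differs from that of `w`, otherwise (degenerate iteration) the new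
  half-line is the spectral projection of `w` -/
  update : ∃ w' : HalfLine n, IsInvariant (strategyMap fa σ') w' ∧
    ((w'.slope ≠ w.slope ∧ w₁ = w') ∨
      (w'.slope = w.slope ∧ w₁ = spectralProjectorHalfLine (strategyMap fa σ') w))

/-- `σ 0, …, σ K` and `w 0, …, w K` are the strategies and half-lines of the first `K` iterations
of a run of the policy iteration algorithm (with arbitrary choices of the initial strategy and
of the invariant half-lines, and of the conservative improvements). -/
structure IsRun {n : ℕ} {A : Fin n → Type*} [∀ i, Fintype (A i)] [∀ i, Nonempty (A i)]
    (fa : (i : Fin n) → A i → (Fin n → ℝ) → ℝ)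
    (σ : ℕ → (i : Fin n) → A i) (w : ℕ → HalfLine n) (K : ℕ) : Prop where
  init : IsInvariant (strategyMap fa (σ 0)) (w 0)
  step : ∀ k < K, IsIteration fa (σ k) (w k) (σ (k + 1)) (w (k + 1))

end MeanPayoff

open MeanPayoff

namespace MeanPayoff

/-! ### Polyhedral maps along half-lines, nonexpansiveness -/

variable {n : ℕ}

/-! The slope of an invariant half-line is the cycle time, so in a degenerate iteration the old and
new maps share a slope `η`. Polyhedrality makes `g(tη + v) = t ĝ(η) + g_η(v)` exact for large `t`,
which reduces everything to the reduced maps `h` (old) and `h'` (new) and the base `v` of the old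
half-line. Here `h v = v`, `h' v ≤ v` by improvement, and `h'` has a fixed point. The orbit of `v`
under `h'` thus decreases and stays bounded, so it converges: this is (3).

Let `h' u = u`, `M ∈ ∂h'(u)` and `F` a recurrence class of `M`. On `F`, `M(v - u) ≤ h' v - u ≤ v -
u`, so the minimum principle makes `v - u` constant on `F` and forces `h' v = v` there
(`IsRecurrenceClass.apply_eq_of_apply_le`). Applied to each iterate, this shows that the orbit is
stationary on `F`, whence (1).

For (2), conservativity gives `h' = h` on the coordinates in `F`. Since `v - u` is constant on `F`,
the rows of `M` in `F` are subgradients of `h` at `v`; other rows are filled with arbitrary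
subgradients, and `F` remains a recurrence class
(`exists_mem_subdifferential_of_isRecurrenceClass`). -/

lemma IsPolyhedron.eventually_mem {S : Set (Fin n → ℝ)} (hS : IsPolyhedron S)
    {η v : Fin n → ℝ} (h : ∃ᶠ t : ℝ in atTop, t • η + v ∈ S) :
    ∀ᶠ t : ℝ in atTop, t • η + v ∈ S := by
  obtain ⟨m, a, b, rfl⟩ := hS
  obtain ⟨t₀, ht₀⟩ := h.exists
  filter_upwards [eventually_ge_atTop t₀] with t ht j
  obtain ⟨t₁, ht₁, ht₁'⟩ := (h.and_eventually (eventually_ge_atTop t)).exists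
  have h₀ := ht₀ j
  have h₁ := ht₁ j
  simp only [dotProduct_add, dotProduct_smul, smul_eq_mul] at h₀ h₁ ⊢
  -- The constraint is affine in `t`: if nondecreasing, compare with the later time `t₁`, otherwise
  -- with `t₀`.
  rcases le_total 0 (a j ⬝ᵥ η) with h | h
  · have := mul_le_mul_of_nonneg_right ht₁' h
    linarith
  · have := mul_le_mul_of_nonpos_right ht h
    linarith

/-- A polyhedral map is eventually affine along every half-line. -/
lemma IsPolyhedralMap.eventually_affine {φ : (Fin n → ℝ) → ℝ} (hφ : IsPolyhedralMap φ)
    (η v : Fin n → ℝ) : ∃ a b : ℝ, ∀ᶠ t : ℝ in atTop, φ (t • η + v) = t * a + b := by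
  obtain ⟨N, S, hS, hcov, haff⟩ := hφ
  have : ∃ j, ∃ᶠ t : ℝ in atTop, t • η + v ∈ S j := by
    by_contra! hcon
    have := eventually_all.2 hcon
    obtain ⟨t, ht⟩ := this.exists
    have hmem : t • η + v ∈ ⋃ j, S j := hcov ▸ Set.mem_univ _
    obtain ⟨j, hj⟩ := Set.mem_iUnion.1 hmem
    exact ht j hj
  obtain ⟨j, hj⟩ := this
  obtain ⟨p, c, hp⟩ := haff j
  refine ⟨p ⬝ᵥ η, p ⬝ᵥ v + c, ?_⟩
  filter_upwards [(hS j).eventually_mem hj] with t ht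
  rw [hp _ ht, dotProduct_add, dotProduct_smul, smul_eq_mul]
  ring

lemma AddHomogeneous.sub_le_norm {φ : (Fin n → ℝ) → ℝ} (hh : AddHomogeneous φ)
    (hm : Monotone φ) (x y : Fin n → ℝ) : φ x - φ y ≤ ‖x - y‖ := by
  have h : x ≤ fun j => ‖x - y‖ + y j := fun j => by
    have := (le_abs_self _).trans (norm_le_pi_norm (x - y) j)
    simp only [Pi.sub_apply] at this
    linarith
  have := hm h
  rw [hh] at this
  linarith

/-- A self-map with order-preserving and additively homogeneous coordinates is nonexpansive in the
sup-norm. -/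
lemma norm_sub_le_norm_sub {g : (Fin n → ℝ) → (Fin n → ℝ)} (hm : Monotone g)
    (hh : ∀ i, AddHomogeneous fun x => g x i) (x y : Fin n → ℝ) : ‖g x - g y‖ ≤ ‖x - y‖ := by
  refine (pi_norm_le_iff_of_nonneg (norm_nonneg _)).2 fun i => abs_le.2 ⟨?_, ?_⟩
  · have := (hh i).sub_le_norm (fun _ _ h => hm h i) y x
    rw [norm_sub_rev] at this
    simp only [Pi.sub_apply]
    linarith
  · exact (hh i).sub_le_norm (fun _ _ h => hm h i) x y

lemma lipschitzWith_one {g : (Fin n → ℝ) → (Fin n → ℝ)} (hm : Monotone g)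
    (hh : ∀ i, AddHomogeneous fun x => g x i) : LipschitzWith 1 g :=
  LipschitzWith.of_dist_le_mul fun x y => by
    simpa [dist_eq_norm] using norm_sub_le_norm_sub hm hh x y

/-- The order-preserving, additively homogeneous and polyhedral self-maps of `ℝⁿ`. -/
structure IsPolyhedralTopical (g : (Fin n → ℝ) → (Fin n → ℝ)) : Prop where
  polyhedral : ∀ i, IsPolyhedralMap fun x => g x i
  monotone : Monotone g
  addHomogeneous : ∀ i, AddHomogeneous fun x => g x i

lemma tendsto_div_atTop_of_eventually_eq_affine {ψ : ℝ → ℝ} {a b : ℝ}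
    (h : ∀ᶠ t in atTop, ψ t = t * a + b) : Tendsto (fun t => ψ t / t) atTop (𝓝 a) := by
  have h₁ : Tendsto (fun t : ℝ => a + b / t) atTop (𝓝 (a + 0)) :=
    tendsto_const_nhds.add (tendsto_const_nhds.div_atTop tendsto_id)
  rw [add_zero] at h₁
  refine h₁.congr' ?_
  filter_upwards [h, eventually_gt_atTop 0] with t ht hpos
  rw [ht]
  field_simp

/-! ### Behaviour at infinity: recession, reduced map, cycle time -/

namespace IsPolyhedralTopical

variable {g : (Fin n → ℝ) → (Fin n → ℝ)}

lemma exists_eventually_eq (hg : IsPolyhedralTopical g) (η v : Fin n → ℝ) (i : Fin n) :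
    ∃ b, ∀ᶠ t : ℝ in atTop, g (t • η + v) i = t * recession g η i + b := by
  obtain ⟨a, b, hab⟩ := (hg.polyhedral i).eventually_affine η v
  obtain ⟨a', b', hab'⟩ := (hg.polyhedral i).eventually_affine η 0
  simp only [add_zero] at hab'
  have hlim' := tendsto_div_atTop_of_eventually_eq_affine hab'
  have hrec : recession g η i = a' := hlim'.limUnder_eq
  have hlim := tendsto_div_atTop_of_eventually_eq_affine hab
  -- Nonexpansiveness bounds the difference by `‖v‖ / t`, so the growth rate along `tη + v` does not
  -- depend on `v`.
  have hz : Tendsto (fun t : ℝ => g (t • η + v) i / t - g (t • η) i / t) atTop (𝓝 0) := by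
    have hb : Tendsto (fun t : ℝ => ‖v‖ / t) atTop (𝓝 0) :=
      tendsto_const_nhds.div_atTop tendsto_id
    refine squeeze_zero_norm' ?_ hb
    filter_upwards [eventually_gt_atTop 0] with t ht
    rw [← sub_div, norm_div, Real.norm_of_nonneg ht.le]
    gcongr
    have h₁ := norm_le_pi_norm (g (t • η + v) - g (t • η)) i
    have h₂ := norm_sub_le_norm_sub hg.monotone hg.addHomogeneous (t • η + v) (t • η)
    rw [add_sub_cancel_left] at h₂
    exact h₁.trans h₂
  have haa : a - a' = 0 := tendsto_nhds_unique (hlim.sub hlim') hz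
  refine ⟨b, ?_⟩
  rw [hrec, ← sub_eq_zero.1 haa]
  exact hab

/-- The limits defining `recession` and `tangent` are attained at finite `t`, so properties of `g`
pass to the reduced map by evaluation at one large `t`. -/
lemma eventually_apply_eq (hg : IsPolyhedralTopical g) (η v : Fin n → ℝ) (i : Fin n) :
    ∀ᶠ t : ℝ in atTop, g (t • η + v) i = t * recession g η i + tangent g η v i := by
  obtain ⟨b, hb⟩ := hg.exists_eventually_eq η v i
  have : tangent g η v i = b := by
    refine Tendsto.limUnder_eq (tendsto_const_nhds.congr' ?_)
    filter_upwards [hb] with t ht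
    rw [ht, add_sub_cancel_left]
  rwa [this]

lemma eventually_eq (hg : IsPolyhedralTopical g) (η v : Fin n → ℝ) :
    ∀ᶠ t : ℝ in atTop, g (t • η + v) = t • recession g η + tangent g η v := by
  filter_upwards [eventually_all.2 (hg.eventually_apply_eq η v)] with t ht
  ext i
  simp [ht i]

lemma isInvariant_iff (hg : IsPolyhedralTopical g) (w : HalfLine n) :
    IsInvariant g w ↔
      recession g w.slope = w.slope ∧ reducedMap g w.slope w.base = w.base := by
  constructor
  · intro h
    have h' : ∀ᶠ t : ℝ in atTop, t • recession g w.slope + tangent g w.slope w.base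
        = (t + 1) • w.slope + w.base := by
      filter_upwards [h, hg.eventually_eq w.slope w.base] with t h₁ h₂
      rw [← h₂]
      exact h₁
    -- Two affine functions of `t` agreeing at `T` and `T + 1` have the same slope and the same
    -- constant term.
    obtain ⟨T, hT⟩ := eventually_atTop.1 h'
    have h₀ := hT T le_rfl
    have h₁ := hT (T + 1) (by linarith)
    constructor
    · ext i
      have e₀ := congrFun h₀ i
      have e₁ := congrFun h₁ i
      simp only [Pi.add_apply, Pi.smul_apply, smul_eq_mul] at e₀ e₁
      linarith
    · ext i
      have e₀ := congrFun h₀ i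
      have e₁ := congrFun h₁ i
      simp only [Pi.add_apply, Pi.smul_apply, smul_eq_mul, reducedMap, Pi.sub_apply] at e₀ e₁ ⊢
      have e : recession g w.slope i = w.slope i := by linarith
      rw [e] at e₀
      linarith
  · rintro ⟨h₁, h₂⟩
    filter_upwards [hg.eventually_eq w.slope w.base] with t ht
    rw [HalfLine.eval, ht, h₁, HalfLine.eval, add_smul, one_smul, add_assoc]
    congr 1
    conv_rhs => rw [← h₂]
    simp [reducedMap]

lemma monotone_reducedMap (hg : IsPolyhedralTopical g) (η : Fin n → ℝ) :
    Monotone (reducedMap g η) := by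
  intro x y hxy i
  obtain ⟨t, h₁, h₂⟩ :=
    ((hg.eventually_apply_eq η x i).and (hg.eventually_apply_eq η y i)).exists
  have := hg.monotone (add_le_add_right hxy (t • η)) i
  simp only [reducedMap, Pi.sub_apply]
  linarith

lemma addHomogeneous_reducedMap (hg : IsPolyhedralTopical g) (η : Fin n → ℝ) (i : Fin n) :
    AddHomogeneous fun x => reducedMap g η x i := by
  intro c x
  obtain ⟨t, h₁, h₂⟩ := ((hg.eventually_apply_eq η x i).and
    (hg.eventually_apply_eq η (fun j => c + x j) i)).exists
  have h₃ := hg.addHomogeneous i c (t • η + x)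
  have h₄ : (fun j => c + (t • η + x) j) = t • η + fun j => c + x j := by
    ext j
    simp only [Pi.add_apply]
    ring
  rw [h₄] at h₃
  simp only [reducedMap, Pi.sub_apply]
  linarith

lemma convexOn_reducedMap (hg : IsPolyhedralTopical g) {i : Fin n}
    (hc : ConvexOn ℝ Set.univ fun x => g x i) (η : Fin n → ℝ) :
    ConvexOn ℝ Set.univ fun x => reducedMap g η x i := by
  refine ⟨convex_univ, fun x _ y _ a b ha hb hab => ?_⟩
  obtain ⟨t, h₁, h₂, h₃⟩ := ((hg.eventually_apply_eq η x i).and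
    ((hg.eventually_apply_eq η y i).and
      (hg.eventually_apply_eq η (a • x + b • y) i))).exists
  have h₄ := hc.2 (Set.mem_univ (t • η + x)) (Set.mem_univ (t • η + y)) ha hb hab
  have h₅ : a • (t • η + x) + b • (t • η + y) = t • η + (a • x + b • y) := by
    rw [smul_add, smul_add, add_add_add_comm, ← add_smul, hab, one_smul]
  simp only [h₅, h₁, h₂, h₃, smul_eq_mul] at h₄
  simp only [reducedMap, Pi.sub_apply, smul_eq_mul]
  obtain rfl : b = 1 - a := by linarith
  nlinarith

lemma lipschitzWith_reducedMap (hg : IsPolyhedralTopical g) (η : Fin n → ℝ) :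
    LipschitzWith 1 (reducedMap g η) :=
  lipschitzWith_one (hg.monotone_reducedMap η) (hg.addHomogeneous_reducedMap η)

/-- An orbit started on the half-line is explicit, and by nonexpansiveness the orbit of `0` stays at
bounded distance from it. -/
lemma cycleTime_eq_slope (hg : IsPolyhedralTopical g) {w : HalfLine n} (hw : IsInvariant g w) :
    cycleTime g = w.slope := by
  obtain ⟨T, hT⟩ := eventually_atTop.1 hw
  have horbit : ∀ k : ℕ, g^[k] (w.eval T) = w.eval (T + k) := by
    intro k
    induction k with
    | zero => simp
    | succ k ih =>
      rw [Function.iterate_succ_apply', ih, hT _ (by simp), Nat.cast_succ, add_assoc]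
  have hinv : Tendsto (fun k : ℕ => (k : ℝ)⁻¹) atTop (𝓝 0) := tendsto_inv_atTop_nhds_zero_nat
  have h₁ : Tendsto (fun k : ℕ => (k : ℝ)⁻¹ • g^[k] (w.eval T)) atTop (𝓝 w.slope) := by
    have : Tendsto (fun k : ℕ => (k : ℝ)⁻¹ • w.eval T + w.slope) atTop
        (𝓝 ((0 : ℝ) • w.eval T + w.slope)) :=
      (hinv.smul_const _).add_const _
    rw [zero_smul, zero_add] at this
    refine this.congr' ?_
    filter_upwards [eventually_gt_atTop 0] with k hk
    have hk' : (k : ℝ) ≠ 0 := by positivity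
    rw [horbit]
    ext i
    simp only [HalfLine.eval, Pi.add_apply, Pi.smul_apply, smul_eq_mul]
    field_simp
    ring
  have h₂ : Tendsto (fun k : ℕ => (k : ℝ)⁻¹ • (g^[k] 0 - g^[k] (w.eval T))) atTop (𝓝 0) := by
    refine squeeze_zero_norm (a := fun k : ℕ => (k : ℝ)⁻¹ * ‖0 - w.eval T‖) (fun k => ?_) ?_
    · rw [norm_smul, norm_inv, RCLike.norm_natCast]
      gcongr
      have := ((lipschitzWith_one hg.monotone hg.addHomogeneous).iterate k).dist_le_mul
        0 (w.eval T)
      simpa [dist_eq_norm] using this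
    · simpa using hinv.mul_const ‖0 - w.eval T‖
  refine Tendsto.limUnder_eq ?_
  have := h₂.add h₁
  simp only [← smul_add, sub_add_cancel, zero_add] at this
  exact this

end IsPolyhedralTopical

/-! ### Spectral projectors and subgradients -/

lemma reducedMap_apply_congr {g g' : (Fin n → ℝ) → (Fin n → ℝ)} {i : Fin n}
    (h : ∀ x, g x i = g' x i) (η x : Fin n → ℝ) :
    reducedMap g η x i = reducedMap g' η x i := by
  simp only [reducedMap, tangent, recession, Pi.sub_apply, h]

/-- The orbit of a subharmonic vector under an order-preserving nonexpansive map with a fixed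
point converges. -/
lemma tendsto_spectralProjector {h : (Fin n → ℝ) → (Fin n → ℝ)} (hm : Monotone h)
    (hl : LipschitzWith 1 h) {v z : Fin n → ℝ} (hz : h z = z) (hv : h v ≤ v) :
    Tendsto (fun k : ℕ => h^[k] v) atTop (𝓝 (spectralProjector h v)) := by
  have hanti : Antitone fun k : ℕ => h^[k] v := hm.antitone_iterate_of_map_le hv
  have hbdd : ∀ i, BddBelow (Set.range fun k : ℕ => (h^[k] v) i) := by
    refine fun i => ⟨z i - ‖v - z‖, ?_⟩
    rintro _ ⟨k, rfl⟩
    have h₁ := (hl.iterate k).dist_le_mul v z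
    rw [Function.iterate_fixed hz] at h₁
    simp only [one_pow, NNReal.coe_one, one_mul, dist_eq_norm] at h₁
    have h₂ := (norm_le_pi_norm (h^[k] v - z) i).trans h₁
    have h₃ := (abs_le.1 h₂).1
    simp only [Pi.sub_apply] at h₃
    simp only
    linarith
  have : Tendsto (fun k : ℕ => h^[k] v) atTop (𝓝 fun i => ⨅ k, (h^[k] v) i) :=
    tendsto_pi_nhds.2 fun i => tendsto_atTop_ciInf (fun a b hab => hanti hab i) (hbdd i)
  exact tendsto_nhds_limUnder ⟨_, this⟩

lemma map_spectralProjector {h : (Fin n → ℝ) → (Fin n → ℝ)} (hc : Continuous h) {v : Fin n → ℝ}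
    (ht : Tendsto (fun k : ℕ => h^[k] v) atTop (𝓝 (spectralProjector h v))) :
    h (spectralProjector h v) = spectralProjector h v := by
  have h₁ := (hc.tendsto _).comp ht
  have h₂ := (tendsto_add_atTop_iff_nat 1).2 ht
  refine tendsto_nhds_unique h₁ (h₂.congr fun k => ?_)
  exact Function.iterate_succ_apply' h k v

/-- Hahn–Banach separates `(u, φ u)` from the open strict epigraph; the separating hyperplane is not
vertical, and dividing by its vertical coefficient `L (0, 1)` gives the subgradient. -/
lemma exists_subgradient {φ : (Fin n → ℝ) → ℝ} (hφ : ConvexOn ℝ Set.univ φ) (hc : Continuous φ)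
    (u : Fin n → ℝ) : ∃ p : Fin n → ℝ, ∀ x, p ⬝ᵥ (x - u) ≤ φ x - φ u := by
  have hconv : Convex ℝ {p : (Fin n → ℝ) × ℝ | φ p.1 < p.2} := by
    simpa using hφ.convex_strict_epigraph
  have hopen : IsOpen {p : (Fin n → ℝ) × ℝ | φ p.1 < p.2} :=
    isOpen_lt (hc.comp continuous_fst) continuous_snd
  obtain ⟨L, hL⟩ := geometric_hahn_banach_point_open (x := (u, φ u)) hconv hopen (by simp)
  have hsplit : ∀ x r, L (x, r) = L (x, 0) + r * L (0, 1) := by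
    intro x r
    rw [← smul_eq_mul, ← map_smul, ← map_add]
    simp
  have hpos : 0 < L (0, 1) := by
    have := hL (u, φ u + 1) (by simp)
    rw [hsplit u, hsplit u (φ u + 1)] at this
    linarith
  have hle : ∀ x, L (u, 0) + φ u * L (0, 1) ≤ L (x, 0) + φ x * L (0, 1) := by
    intro x
    refine le_of_forall_pos_le_add fun ε hε => ?_
    have := hL (x, φ x + ε / L (0, 1)) (by simp; positivity)
    rw [hsplit u, hsplit x, add_mul, div_mul_cancel₀ _ hpos.ne'] at this
    linarith
  let ℓ : (Fin n → ℝ) →ₗ[ℝ] ℝ := L.toLinearMap ∘ₗ LinearMap.inl ℝ _ _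
  refine ⟨fun j => -(ℓ (Pi.single j 1)) / L (0, 1), fun x => ?_⟩
  have hℓ : ∀ y, (fun j => -(ℓ (Pi.single j 1)) / L (0, 1)) ⬝ᵥ y = -(ℓ y) / L (0, 1) := by
    intro y
    conv_rhs => rw [LinearMap.pi_apply_eq_sum_univ ℓ y]
    rw [← Finset.sum_neg_distrib, Finset.sum_div, dotProduct]
    refine Finset.sum_congr rfl fun j _ => ?_
    have : (Pi.single j 1 : Fin n → ℝ) = fun i => if j = i then 1 else 0 := by
      ext i
      simp [Pi.single_apply, eq_comm]
    rw [this, smul_eq_mul]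
    ring
  rw [hℓ, div_le_iff₀ hpos, map_sub]
  have := hle x
  simp only [ℓ, LinearMap.comp_apply, LinearMap.inl_apply, ContinuousLinearMap.coe_coe]
  linarith

/-! ### Recurrence classes of subgradients -/

namespace IsRecurrenceClass

variable {M : Matrix (Fin n) (Fin n) ℝ} {F : Finset (Fin n)}

lemma apply_nonneg (hF : IsRecurrenceClass M F) {i j : Fin n} (hi : i ∈ F) (hj : j ∈ F) :
    0 ≤ M i j :=
  hF.stochastic.1 ⟨i, hi⟩ ⟨j, hj⟩

lemma sum_eq_one (hF : IsRecurrenceClass M F) {i : Fin n} (hi : i ∈ F) :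
    ∑ j ∈ F, M i j = 1 := by
  rw [← Finset.sum_coe_sort]
  exact Matrix.sum_row_of_mem_rowStochastic hF.stochastic ⟨i, hi⟩

lemma mulVec_eq (hF : IsRecurrenceClass M F) {i : Fin n} (hi : i ∈ F) (z : Fin n → ℝ) :
    M.mulVec z i = ∑ j ∈ F, M i j * z j := by
  refine (Finset.sum_subset F.subset_univ fun j _ hj => ?_).symm
  simp [hF.final i hi j hj]

lemma mulVec_eq_of_forall_eq (hF : IsRecurrenceClass M F) {i : Fin n} (hi : i ∈ F)
    {z : Fin n → ℝ} {c : ℝ} (hz : ∀ j ∈ F, z j = c) : M.mulVec z i = c := by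
  rw [hF.mulVec_eq hi, Finset.sum_congr rfl fun j hj => by rw [hz j hj], ← Finset.sum_mul,
    hF.sum_eq_one hi, one_mul]

/-- A vector that is superharmonic on a recurrence class is constant there. -/
lemma exists_forall_eq_of_mulVec_le (hF : IsRecurrenceClass M F) {z : Fin n → ℝ}
    (hz : ∀ i ∈ F, M.mulVec z i ≤ z i) : ∃ c, ∀ i ∈ F, z i = c := by
  obtain ⟨i₀, hi₀, hmin⟩ := F.exists_min_image z hF.nonempty
  refine ⟨z i₀, fun j hj => ?_⟩
  have hacc := ((hF.communication i₀ hi₀ j).1 hj).1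
  -- Minimality propagates along edges: at a minimizing node, a weighted sum of nonnegative gaps is
  -- at most zero, so each gap of nonzero weight vanishes.
  suffices j ∈ F ∧ z j = z i₀ from this.2
  clear hj
  induction hacc with
  | refl => exact ⟨hi₀, rfl⟩
  | @tail k l _ hkl ih =>
    obtain ⟨hk, hzk⟩ := ih
    have hl : l ∈ F := by
      by_contra hl
      exact hkl (hF.final k hk l hl)
    refine ⟨hl, ?_⟩
    have hsum : ∑ j ∈ F, M k j * (z j - z i₀) ≤ 0 := by
      have := hz k hk
      rw [hF.mulVec_eq hk, hzk] at this
      simp only [mul_sub, Finset.sum_sub_distrib, ← Finset.sum_mul, hF.sum_eq_one hk, one_mul]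
      linarith
    have hnn : ∀ j ∈ F, 0 ≤ M k j * (z j - z i₀) := fun j hj =>
      mul_nonneg (hF.apply_nonneg hk hj) (sub_nonneg.2 (hmin j hj))
    have := (Finset.sum_eq_zero_iff_of_nonneg hnn).1
      (hsum.antisymm (Finset.sum_nonneg hnn)) l hl
    exact sub_eq_zero.1 ((mul_eq_zero.1 this).resolve_left hkl)

lemma mem_of_accessible (hF : IsRecurrenceClass M F) {i j : Fin n} (hi : i ∈ F)
    (h : Accessible M i j) : j ∈ F := by
  induction h with
  | refl => exact hi
  | @tail k l _ hkl ih =>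
    by_contra hl
    exact hkl (hF.final k ih l hl)

/-- A path starting in `F` never leaves `F`, so it only uses rows indexed by `F`. -/
lemma accessible_of_rows_eq (hF : IsRecurrenceClass M F) {M' : Matrix (Fin n) (Fin n) ℝ}
    (hM : ∀ i ∈ F, M' i = M i) {i j : Fin n} (hi : i ∈ F) (h : Accessible M i j) :
    Accessible M' i j := by
  induction h with
  | refl => exact .refl
  | @tail k l hik hkl ih =>
    refine ih.tail ?_
    rwa [hM k (hF.mem_of_accessible hi hik)]

/-- Being a recurrence class depends only on the rows indexed by the class. -/
lemma of_rows_eq (hF : IsRecurrenceClass M F) {M' : Matrix (Fin n) (Fin n) ℝ}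
    (hM : ∀ i ∈ F, M' i = M i) : IsRecurrenceClass M' F where
  nonempty := hF.nonempty
  final i hi j hj := by rw [hM i hi, hF.final i hi j hj]
  stochastic := by
    convert hF.stochastic using 1
    ext i j
    simp [hM i i.2]
  communication i hi j := by
    constructor
    · intro hj
      obtain ⟨h₁, h₂⟩ := (hF.communication i hi j).1 hj
      exact ⟨hF.accessible_of_rows_eq hM hi h₁, hF.accessible_of_rows_eq hM hj h₂⟩
    · rintro ⟨h, -⟩
      induction h with
      | refl => exact hi
      | @tail k l _ hkl ih =>
        by_contra hl
        rw [hM k ih] at hkl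
        exact hkl (hF.final k ih l hl)

/-- If `v` is subharmonic for a map `h`, then `v` is harmonic on the recurrence classes of the
subgradients of `h` at its fixed points, and differs there from the fixed point by a constant. -/
lemma apply_eq_of_apply_le (hF : IsRecurrenceClass M F) {h : (Fin n → ℝ) → (Fin n → ℝ)}
    {u v : Fin n → ℝ} (hu : h u = u) (hM : M ∈ subdifferential h u) (hv : h v ≤ v) :
    (∃ c, ∀ i ∈ F, (v - u) i = c) ∧ ∀ i ∈ F, h v i = v i := by
  have hle : ∀ i, M.mulVec (v - u) i ≤ h v i - u i := fun i => by
    have := hM v i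
    rw [hu] at this
    exact this
  obtain ⟨c, hc⟩ := hF.exists_forall_eq_of_mulVec_le (z := v - u) fun i _ =>
    (hle i).trans (sub_le_sub_right (hv i) _)
  refine ⟨⟨c, hc⟩, fun i hi => le_antisymm (hv i) ?_⟩
  have h₁ := hle i
  rw [hF.mulVec_eq_of_forall_eq hi hc, ← hc i hi] at h₁
  simp only [Pi.sub_apply] at h₁
  linarith

/-- Each iterate `y` again satisfies `h y ≤ y`, so `apply_eq_of_apply_le` applies to it in turn. -/
lemma iterate_apply_eq (hF : IsRecurrenceClass M F) {h : (Fin n → ℝ) → (Fin n → ℝ)}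
    (hm : Monotone h) {u v : Fin n → ℝ} (hu : h u = u) (hM : M ∈ subdifferential h u)
    (hv : h v ≤ v) {i : Fin n} (hi : i ∈ F) (k : ℕ) : h^[k] v i = v i := by
  induction k with
  | zero => rfl
  | succ k ih =>
    rw [← ih, Function.iterate_succ_apply']
    refine (hF.apply_eq_of_apply_le hu hM ?_).2 i hi
    rw [← Function.iterate_succ_apply' h k v]
    exact hm.antitone_iterate_of_map_le hv k.le_succ

end IsRecurrenceClass

lemma exists_mem_subdifferential_of_isRecurrenceClass {h h' : (Fin n → ℝ) → (Fin n → ℝ)}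
    (hconv : ∀ i, ConvexOn ℝ Set.univ fun x => h x i) (hcont : Continuous h)
    {M : Matrix (Fin n) (Fin n) ℝ} {F : Finset (Fin n)} (hF : IsRecurrenceClass M F)
    {u v : Fin n → ℝ} (hu : h' u = u) (hv : h v = v) (hM : M ∈ subdifferential h' u)
    (hv' : h' v ≤ v) (heq : ∀ i, h' v i = v i → ∀ x, h' x i = h x i) :
    ∃ M' ∈ subdifferential h v, IsRecurrenceClass M' F := by
  obtain ⟨⟨c, hc⟩, hfix⟩ := hF.apply_eq_of_apply_le hu hM hv'
  choose p hp using fun i => exists_subgradient (hconv i) ((continuous_apply i).comp hcont) v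
  let M' : Matrix (Fin n) (Fin n) ℝ := fun i => if i ∈ F then M i else p i
  refine ⟨M', fun x i => ?_, hF.of_rows_eq fun i hi => if_pos hi⟩
  by_cases hi : i ∈ F
  · have h₁ : M'.mulVec (x - v) i = M.mulVec (x - v) i := by simp [Matrix.mulVec, M', hi]
    -- Moving the base point from `u` to `v` costs `M(v - u)`, which equals `v - u` on `F` because
    -- it is constant there.
    have h₂ : M.mulVec (x - v) i = M.mulVec (x - u) i - M.mulVec (v - u) i := by
      rw [← Pi.sub_apply, ← Matrix.mulVec_sub, sub_sub_sub_cancel_right]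
    have h₃ := hM x i
    rw [hu] at h₃
    rw [h₁, h₂, hF.mulVec_eq_of_forall_eq hi hc, ← hc i hi, hv]
    simp only [Pi.sub_apply, heq i (hfix i hi) x] at h₃ ⊢
    linarith
  · have h₁ : M'.mulVec (x - v) i = p i ⬝ᵥ (x - v) := by simp [Matrix.mulVec, M', hi]
    rw [h₁]
    exact hp i x

/-! ### Iterations of the algorithm -/

lemma isPolyhedralTopical_strategyMap {A : Fin n → Type*}
    {fa : (i : Fin n) → A i → (Fin n → ℝ) → ℝ} (h_poly : ∀ i a, IsPolyhedralMap (fa i a))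
    (h_mono : ∀ i a, Monotone (fa i a)) (h_hom : ∀ i a, AddHomogeneous (fa i a))
    (σ : (i : Fin n) → A i) : IsPolyhedralTopical (strategyMap fa σ) where
  polyhedral i := h_poly i (σ i)
  monotone _ _ hxy i := h_mono i (σ i) hxy
  addHomogeneous i := h_hom i (σ i)

variable {A : Fin n → Type*} [∀ i, Fintype (A i)] [∀ i, Nonempty (A i)]
  {fa : (i : Fin n) → A i → (Fin n → ℝ) → ℝ}

lemma minMap_le_strategyMap (σ : (i : Fin n) → A i) (x : Fin n → ℝ) :
    minMap fa x ≤ strategyMap fa σ x :=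
  fun i => Finset.inf'_le (fun a => fa i a x) (Finset.mem_univ (σ i))

namespace IsIteration

variable {σ σ' : (i : Fin n) → A i} {w w₁ : HalfLine n}

/-- On `w(t)` the new map attains the minimum, hence lies below the old map, whose value is `w(t +
1)`; the terms in `t` cancel. -/
lemma reducedMap_base_le (h : IsIteration fa σ w σ' w₁)
    (hg : IsPolyhedralTopical (strategyMap fa σ')) (hw : IsInvariant (strategyMap fa σ) w)
    (hrec : recession (strategyMap fa σ') w.slope = w.slope) :
    reducedMap (strategyMap fa σ') w.slope w.base ≤ w.base := by
  obtain ⟨t, h₁, h₂, h₃⟩ := (hw.and (h.improve.and (hg.eventually_eq w.slope w.base))).exists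
  have h₄ := minMap_le_strategyMap (fa := fa) σ (w.eval t)
  rw [h₁, h₂, HalfLine.eval, h₃, hrec, HalfLine.eval] at h₄
  intro i
  have := h₄ i
  simp only [Pi.add_apply, Pi.smul_apply, smul_eq_mul, reducedMap, Pi.sub_apply] at this ⊢
  linarith

lemma strategy_eq_of_reducedMap_eq (h : IsIteration fa σ w σ' w₁)
    (hg : IsPolyhedralTopical (strategyMap fa σ')) (hw : IsInvariant (strategyMap fa σ) w)
    (hrec : recession (strategyMap fa σ') w.slope = w.slope) {i : Fin n}
    (hi : reducedMap (strategyMap fa σ') w.slope w.base i = w.base i) : σ' i = σ i := by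
  refine h.conservative i ?_
  filter_upwards [hw, h.improve, hg.eventually_eq w.slope w.base] with t h₁ h₂ h₃
  rw [h₁, h₂, HalfLine.eval, h₃, hrec, HalfLine.eval]
  simp only [Pi.add_apply, Pi.smul_apply, smul_eq_mul, reducedMap, Pi.sub_apply] at hi ⊢
  linarith

/-- `spectralProjector` is a `limUnder`, meaningful only once convergence is established. -/
lemma spectralProjector_spec (h : IsIteration fa σ w σ' w₁)
    (hg : IsPolyhedralTopical (strategyMap fa σ')) (hw : IsInvariant (strategyMap fa σ) w)
    {w' : HalfLine n} (hw' : IsInvariant (strategyMap fa σ') w') (hs : w'.slope = w.slope) :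
    Tendsto (fun k : ℕ => (reducedMap (strategyMap fa σ') w.slope)^[k] w.base) atTop
      (𝓝 (spectralProjector (reducedMap (strategyMap fa σ') w.slope) w.base)) := by
  obtain ⟨hrec, hfix⟩ := (hg.isInvariant_iff w').1 hw'
  rw [hs] at hrec hfix
  exact tendsto_spectralProjector (hg.monotone_reducedMap _) (hg.lipschitzWith_reducedMap _) hfix
    (h.reducedMap_base_le hg hw hrec)

lemma isInvariant (h : IsIteration fa σ w σ' w₁)
    (hg : IsPolyhedralTopical (strategyMap fa σ')) (hw : IsInvariant (strategyMap fa σ) w) :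
    IsInvariant (strategyMap fa σ') w₁ := by
  obtain ⟨w', hw', ⟨-, rfl⟩ | ⟨hs, rfl⟩⟩ := h.update
  · exact hw'
  · rw [hg.isInvariant_iff]
    refine ⟨hs ▸ ((hg.isInvariant_iff w').1 hw').1, ?_⟩
    exact map_spectralProjector (hg.lipschitzWith_reducedMap _).continuous
      (h.spectralProjector_spec hg hw hw' hs)

end IsIteration

/-- In the degenerate branch invariance is not part of the update: it comes from the projected base
being a fixed point of the reduced map. -/
lemma IsRun.isInvariant {σ : ℕ → (i : Fin n) → A i} {w : ℕ → HalfLine n} {K : ℕ}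
    (h : IsRun fa σ w K) (hg : ∀ σ, IsPolyhedralTopical (strategyMap fa σ)) :
    ∀ k ≤ K, IsInvariant (strategyMap fa (σ k)) (w k) := by
  intro k
  induction k with
  | zero => exact fun _ => h.init
  | succ k ih => exact fun hk => (h.step k hk).isInvariant (hg _) (ih (Nat.le_of_lt hk))

end MeanPayoff

theorem lemma4p5 {n : ℕ} {A : Fin n → Type*} [∀ i, Fintype (A i)] [∀ i, Nonempty (A i)]
    (fa : (i : Fin n) → A i → (Fin n → ℝ) → ℝ)
    (h_poly : ∀ i a, IsPolyhedralMap (fa i a))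
    (h_mono : ∀ i a, Monotone (fa i a))
    (h_hom : ∀ i a, AddHomogeneous (fa i a))
    (h_conv : ∀ i a, ConvexOn ℝ Set.univ (fa i a))
    (σ : ℕ → (i : Fin n) → A i) (w : ℕ → HalfLine n) (K : ℕ)
    (h_run : IsRun fa σ w K)
    (k : ℕ) (hk : k < K)
    (h_deg : cycleTime (strategyMap fa (σ (k + 1))) = cycleTime (strategyMap fa (σ k))) :
    (∀ i ∈ criticalNodes (strategyMap fa (σ (k + 1))), ∀ t : ℝ,
      (w (k + 1)).eval t i = (w k).eval t i) ∧
    criticalNodes (strategyMap fa (σ (k + 1))) ⊆ criticalNodes (strategyMap fa (σ k)) ∧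
    (∀ t : ℝ, (w (k + 1)).eval t ≤ (w k).eval t) := by
  have hg := isPolyhedralTopical_strategyMap h_poly h_mono h_hom
  have hit := h_run.step k hk
  have hw := h_run.isInvariant hg k hk.le
  obtain ⟨w', hw', hcase⟩ := hit.update
  have hs : w'.slope = (w k).slope := by
    rw [← (hg _).cycleTime_eq_slope hw', ← (hg _).cycleTime_eq_slope hw, h_deg]
  have hw₁ := (hcase.resolve_left fun h => h.1 hs).2
  have hrec : recession (strategyMap fa (σ (k + 1))) (w k).slope = (w k).slope :=
    hs ▸ (((hg _).isInvariant_iff w').1 hw').1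
  have hmono := (hg (σ (k + 1))).monotone_reducedMap (w k).slope
  have hle := hit.reducedMap_base_le (hg _) hw hrec
  have htend := hit.spectralProjector_spec (hg _) hw hw' hs
  -- `criticalNodes` allows any invariant half-line, but its slope is always the cycle time, here
  -- that of `w k`.
  have hcrit : ∀ i ∈ criticalNodes (strategyMap fa (σ (k + 1))),
      i ∈ harmonicCriticalNodes (reducedMap (strategyMap fa (σ (k + 1))) (w k).slope) := by
    rintro i ⟨w'', hw'', hi⟩
    rwa [← (hg _).cycleTime_eq_slope hw'', (hg _).cycleTime_eq_slope hw', hs] at hi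
  rw [hw₁]
  refine ⟨fun i hi t => ?_, fun i hi => ?_, fun t => ?_⟩
  · obtain ⟨u, hu, M, hM, F, hF, hiF⟩ := hcrit i hi
    have hlim := (tendsto_pi_nhds.1 htend i).congr
      (hF.iterate_apply_eq hmono hu hM hle hiF)
    have := tendsto_nhds_unique hlim tendsto_const_nhds
    simp only [HalfLine.eval, spectralProjectorHalfLine, Pi.add_apply, this]
  · obtain ⟨u, hu, M, hM, F, hF, hiF⟩ := hcrit i hi
    obtain ⟨M', hM', hF'⟩ := exists_mem_subdifferential_of_isRecurrenceClass
      (fun i => (hg (σ k)).convexOn_reducedMap (h_conv i (σ k i)) (w k).slope)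
      ((hg (σ k)).lipschitzWith_reducedMap _).continuous hF hu
      (((hg (σ k)).isInvariant_iff _).1 hw).2 hM hle fun i hi x =>
        reducedMap_apply_congr (fun x => by
          simp only [strategyMap, hit.strategy_eq_of_reducedMap_eq (hg _) hw hrec hi]) _ x
    exact ⟨w k, hw, (w k).base, (((hg (σ k)).isInvariant_iff _).1 hw).2, M', hM', F, hF', hiF⟩
  · refine add_le_add_right (le_of_tendsto htend (Eventually.of_forall fun m => ?_)) _
    exact hmono.antitone_iterate_of_map_le hle m.zero_le
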